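/- **Proposition (the self-linking number of the blackboard framing is the writhe).** Let $K:\mathbb R/\mathbb Z\to\mathbb R^3\subset S^3$ be an oriented smooth knot (a smooth embedding) whose projection to the $xy$-plane, seen from above, is a knot diagram: the projection is an immersion with finitely many multiple points, all of them transverse double points (the crossings), the higher strand passing over. The *sign* of a crossing is $+1$ if the velocity of the over-strand followed by that of the under-strand projects to a positively oriented basis of the plane, and $-1$ otherwise. The *writhe* $w(K)$ is the sum of the signs of all crossings of the diagram. If the projection of a two-component oriented link $J\cup K$ is a link diagram in the same sense, $lk(J,K)$ is half the sum of the signs of the crossings between $J$ and $K$ in that diagram. Let $V$ be a blackboard framing of $K$, i.e. a continuous nowhere vanishing vector field along $K$ that is normal to $K$ and everywhere parallel to the $xy$-plane. A *push-off* of $K$ along $V$ is a smooth closed curve $K'$, parametrized parallel to $K$, with $K'(t)=K(t)+r(t)V(t)$ and $r(t)>0$ for all $t$; its size is measured by $\sup_t|K'(t)-K(t)|$ and $\sup_t|\dot K'(t)-\dot K(t)|$. Then there are push-offs of $K$ along $V$ of arbitrarily small size, and there is $\delta>0$ such that every push-off $K'$ of size less than $\delta$ is a knot disjoint from $K$, the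 projection of $K\cup K'$ is a link diagram, and $$lk(K,K')=w(K).$$ In other words, the self-linking number of the framed knot $(K,V)$ equals the writhe of the diagram. -/

import Mathlib

open scoped ContDiff

namespace BlackboardFraming

/-- Euclidean three-space, regarded as the three-sphere minus a point. -/
abbrev E3 : Type := EuclideanSpace ℝ (Fin 3)

/-- Orthogonal projection to the blackboard, the oriented `xy`-plane. It is viewed from above,
so the third coordinate of a point is its height over the blackboard. -/
noncomputable def proj (x : E3) : EuclideanSpace ℝ (Fin 2) := !₂[x 0, x 1]

/-- The determinant of the projections of `v` and `w` to the blackboard. -/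
noncomputable def planeDet (v w : E3) : ℝ := v 0 * w 1 - v 1 * w 0

/-- A smooth closed curve, given as a `1`-periodic function; the parameter orients it. -/
structure IsSmoothLoop (K : ℝ → E3) : Prop where
  smooth : ContDiff ℝ ∞ K
  periodic : Function.Periodic K 1

/-- An oriented knot: a smooth embedding of the circle `ℝ / ℤ`. -/
structure IsKnot (K : ℝ → E3) : Prop extends IsSmoothLoop K where
  immersed : ∀ t, deriv K t ≠ 0
  injective : Set.InjOn K (Set.Ico 0 1)

/-- An oriented link with components indexed by `ι`. -/
structure IsLink {ι : Type} (L : ι → ℝ → E3) : Prop where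
  knot : ∀ i, IsKnot (L i)
  disjoint : ∀ i j, i ≠ j → Disjoint (Set.range (L i)) (Set.range (L j))

/-- The pairs of distinct points of the link `L` with the same projection. A point is recorded
by its component and its parameter in `[0, 1)`; each crossing is listed in both orders. -/
def doublePoints {ι : Type} (L : ι → ℝ → E3) : Set ((ι × ℝ) × (ι × ℝ)) :=
  {c | c.1.2 ∈ Set.Ico (0 : ℝ) 1 ∧ c.2.2 ∈ Set.Ico (0 : ℝ) 1 ∧ c.1 ≠ c.2 ∧
    proj (L c.1.1 c.1.2) = proj (L c.2.1 c.2.2)}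

/-- The link `L` projects to a link diagram on the blackboard: the projection is an immersion
with finitely many crossings, all of them transverse double points. Which strand passes over at
a crossing is read off from the heights. -/
structure IsLinkDiagram {ι : Type} (L : ι → ℝ → E3) : Prop where
  link : IsLink L
  immersed : ∀ i t, proj (deriv (L i) t) ≠ 0
  finite : (doublePoints L).Finite
  transverse : ∀ c ∈ doublePoints L,
    planeDet (deriv (L c.1.1) c.1.2) (deriv (L c.2.1) c.2.2) ≠ 0
  double : ∀ x y z : ι × ℝ, (x, y) ∈ doublePoints L → (x, z) ∈ doublePoints L → y = z

/-- The knot `K` projects to a knot diagram on the blackboard. -/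
def IsKnotDiagram (K : ℝ → E3) : Prop := IsLinkDiagram (fun _ : Unit => K)

/-- The sign of the crossing of the strand of `J` at `s` with the strand of `K` at `t`: it is `1`
if the velocity of the over-strand followed by that of the under-strand is a positively oriented
basis of the blackboard, and `-1` if it is a negatively oriented one. -/
noncomputable def crossingSign (J K : ℝ → E3) (s t : ℝ) : ℤ :=
  if K t 2 < J s 2 then (SignType.sign (planeDet (deriv J s) (deriv K t)) : ℤ)
  else (SignType.sign (planeDet (deriv K t) (deriv J s)) : ℤ)

/-- The crossings of the diagram of a knot, each listed once. -/
def selfCrossings (K : ℝ → E3) : Set (ℝ × ℝ) :=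
  {c | 0 ≤ c.1 ∧ c.1 < c.2 ∧ c.2 < 1 ∧ proj (K c.1) = proj (K c.2)}

/-- The crossings between the two components of the diagram of the link `J ∪ K`. -/
def mixedCrossings (J K : ℝ → E3) : Set (ℝ × ℝ) :=
  {c | c.1 ∈ Set.Ico (0 : ℝ) 1 ∧ c.2 ∈ Set.Ico (0 : ℝ) 1 ∧ proj (J c.1) = proj (K c.2)}

/-- The writhe of a knot diagram: the sum of the signs of all its crossings. -/
noncomputable def writhe (K : ℝ → E3) : ℤ :=
  ∑ᶠ c ∈ selfCrossings K, crossingSign K K c.1 c.2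

/-- The linking number: half the sum of the signs of the crossings between `J` and `K` in the
diagram of `J ∪ K`. (Used together with `IsLinkDiagram ![J, K]`.) -/
noncomputable def lk (J K : ℝ → E3) : ℚ :=
  ((∑ᶠ c ∈ mixedCrossings J K, crossingSign J K c.1 c.2 : ℤ) : ℚ) / 2

/-- A framing of the knot `K`: a continuous nonvanishing vector field normal to `K`. -/
structure IsFraming (K V : ℝ → E3) : Prop where
  continuous : Continuous V
  periodic : Function.Periodic V 1
  ne_zero : ∀ t, V t ≠ 0
  normal : ∀ t, inner ℝ (V t) (deriv K t) = 0

/-- A blackboard framing: a framing that is everywhere parallel to the blackboard. -/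
structure IsBlackboardFraming (K V : ℝ → E3) : Prop extends IsFraming K V where
  parallel : ∀ t, V t 2 = 0

/-- `K'` is a push-off of `K` along `V` of size less than `δ`, oriented parallel to `K`: a smooth
closed curve obtained by moving each point `K t` in the direction of `V t` (by an amount that may
depend on `t`), closer than `δ` to `K` in position and velocity. -/
structure IsPushOff (K V : ℝ → E3) (δ : ℝ) (K' : ℝ → E3) : Prop where
  loop : IsSmoothLoop K'
  shift : ∀ t, ∃ r : ℝ, 0 < r ∧ K' t = K t + r • V t
  close : ∀ t, ‖K' t - K t‖ < δ
  close_deriv : ∀ t, ‖deriv K' t - deriv K t‖ < δ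

/-- The self-linking number of the framed knot `(K, V)` is `n`: there are arbitrarily small
push-offs of `K` along `V`, and each sufficiently small one, `K'`, is a knot disjoint from `K`
such that `K ∪ K'` projects to a link diagram, in which `lk (K, K') = n`. -/
def HasSelfLinkingNumber (K V : ℝ → E3) (n : ℚ) : Prop :=
  (∀ δ > 0, ∃ K', IsPushOff K V δ K') ∧
  ∃ δ > 0, ∀ K', IsPushOff K V δ K' → IsLinkDiagram ![K, K'] ∧ lk K K' = n

end BlackboardFraming

namespace BlackboardFraming

open Set Filter Topology

/-! Crossings between `K` and a small push-off `J` are the zeros of `crossingMap K J (s, t) = proj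
(K s) - proj (J t)`, a small C¹ perturbation of `crossingMap K K`. Off the diagonal, the zeros of
`crossingMap K K` are the crossings of `K`, each in both orders. Transversality makes them
nondegenerate, so each persists as exactly one zero with the same sign, and compactness excludes
further zeros (`IsKnotDiagram.eventually_exists_bijOn`).

On the diagonal `crossingMap K K` vanishes identically, and the framing is needed: `J` is displaced
at right angles to the projected velocity, while `K` moves strictly monotonically along it for a
short time, so no crossings arise there (`exists_eq_of_proj_eq`). The signs thus sum to twice the
writhe (`IsKnotDiagram.finsum_crossings`), and halving gives the linking number.

Applied to all pairs of components, the same correspondence gives finiteness, transversality and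
embeddedness of the link; triple points are excluded by compactness
(`IsKnotDiagram.eventually_no_triple_points`). Push-offs exist because `V` has a constant side with
respect to the smooth planar normal of `K` (`exists_isPushOff`). -/

/-- The Euclidean inner product of the projections of `v` and `w` to the blackboard. -/
noncomputable def planeInner (v w : E3) : ℝ := v 0 * w 0 + v 1 * w 1

lemma proj_eq_iff {v w : E3} : proj v = proj w ↔ v 0 = w 0 ∧ v 1 = w 1 := by
  constructor
  · intro h
    exact ⟨by simpa [proj] using congrArg (fun x => x 0) h,
      by simpa [proj] using congrArg (fun x => x 1) h⟩
  · rintro ⟨h0, h1⟩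
    simp [proj, h0, h1]

lemma proj_eq_zero_iff {v : E3} : proj v = 0 ↔ v 0 = 0 ∧ v 1 = 0 := by
  have : proj 0 = 0 := by ext i; fin_cases i <;> simp [proj]
  rw [← this, proj_eq_iff]
  simp

lemma ext_of_coords {v w : E3} (h0 : v 0 = w 0) (h1 : v 1 = w 1) (h2 : v 2 = w 2) : v = w := by
  ext i
  fin_cases i <;> assumption

lemma planeInner_self_pos {v : E3} (h : proj v ≠ 0) : 0 < planeInner v v := by
  have : ¬(v 0 = 0 ∧ v 1 = 0) := fun h' => h (proj_eq_zero_iff.2 h')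
  unfold planeInner
  rcases not_and_or.1 this with h | h
  · nlinarith [mul_self_pos.2 h, mul_self_nonneg (v 1)]
  · nlinarith [mul_self_pos.2 h, mul_self_nonneg (v 0)]

lemma proj_ne_zero_of_planeInner_pos {v w : E3} (h : 0 < planeInner v w) : proj v ≠ 0 := by
  intro h'
  obtain ⟨h0, h1⟩ := proj_eq_zero_iff.1 h'
  simp [planeInner, h0, h1] at h

lemma continuous_planeInner : Continuous fun p : E3 × E3 => planeInner p.1 p.2 := by
  unfold planeInner
  fun_prop

lemma continuous_planeDet : Continuous fun p : E3 × E3 => planeDet p.1 p.2 := by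
  unfold planeDet
  fun_prop

/-- `J` is a smooth closed curve closer than `δ` to `K` in position and velocity. -/
structure IsNear (K : ℝ → E3) (δ : ℝ) (J : ℝ → E3) : Prop where
  loop : IsSmoothLoop J
  close : ∀ t, ‖J t - K t‖ < δ
  close_deriv : ∀ t, ‖deriv J t - deriv K t‖ < δ

lemma IsSmoothLoop.isNear_self {K : ℝ → E3} (hK : IsSmoothLoop K) {δ : ℝ} (hδ : 0 < δ) :
    IsNear K δ K :=
  ⟨hK, by simpa using hδ, by simpa using hδ⟩

lemma IsPushOff.isNear {K V J : ℝ → E3} {δ : ℝ} (h : IsPushOff K V δ J) : IsNear K δ J :=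
  ⟨h.loop, h.close, h.close_deriv⟩

lemma IsNear.mono {K J : ℝ → E3} {δ δ' : ℝ} (h : IsNear K δ J) (hδ : δ ≤ δ') : IsNear K δ' J :=
  ⟨h.loop, fun t => (h.close t).trans_le hδ, fun t => (h.close_deriv t).trans_le hδ⟩

namespace IsSmoothLoop

variable {K : ℝ → E3} (hK : IsSmoothLoop K)
include hK

lemma differentiable : Differentiable ℝ K := hK.smooth.differentiable (by simp)

lemma continuous : Continuous K := hK.smooth.continuous

lemma contDiff_deriv : ContDiff ℝ ∞ (deriv K) :=
  (contDiff_infty_iff_deriv.1 hK.smooth).2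

lemma periodic_deriv : Function.Periodic (deriv K) 1 := by
  intro t
  have : deriv (fun x => K (x + 1)) t = deriv K (t + 1) := deriv_comp_add_const K 1 t
  rw [← this, funext hK.periodic]

lemma add_int (t : ℝ) (n : ℤ) : K (t + n) = K t := by
  simpa using hK.periodic.int_mul n t

lemma deriv_add_int (t : ℝ) (n : ℤ) : deriv K (t + n) = deriv K t := by
  simpa using hK.periodic_deriv.int_mul n t

end IsSmoothLoop

/-! ### Absence of crossings near the diagonal. -/

section NearDiagonal

/-- Nearby velocities of an immersed planar curve, even slightly perturbed, point in roughly the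
same direction. -/
lemma exists_planeInner_deriv_pos {K : ℝ → E3} (hK : IsSmoothLoop K)
    (him : ∀ t, proj (deriv K t) ≠ 0) :
    ∃ η > 0, ∀ J, IsNear K η J → ∀ s t, |s - t| < η →
      0 < planeInner (deriv J s) (deriv K t) := by
  have hc := hK.contDiff_deriv.continuous
  -- Here `p.1` stands for `s - t` and `p.2` for `deriv J s - deriv K s`; compactness of one period
  -- makes the neighbourhood uniform in `t`.
  have key : ∀ᶠ p : ℝ × E3 in 𝓝 (0, 0), ∀ t ∈ Icc (0 : ℝ) 1,
      0 < planeInner (deriv K (t + p.1) + p.2) (deriv K t) := by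
    refine isCompact_Icc.eventually_forall_of_forall_eventually fun t _ => ?_
    have hcont : Continuous fun z : (ℝ × E3) × ℝ =>
        planeInner (deriv K (z.2 + z.1.1) + z.1.2) (deriv K z.2) :=
      continuous_planeInner.comp (by fun_prop : Continuous fun z : (ℝ × E3) × ℝ =>
        (deriv K (z.2 + z.1.1) + z.1.2, deriv K z.2))
    refine hcont.continuousAt.eventually (lt_mem_nhds ?_)
    simpa using planeInner_self_pos (him t)
  obtain ⟨η, hη, h⟩ := Metric.eventually_nhds_iff.1 key
  refine ⟨η, hη, fun J hJ s t hst => ?_⟩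
  have h1 := @h (s - t, deriv J s - deriv K s) (by
    rw [Prod.dist_eq, max_lt_iff]
    exact ⟨by simpa [Real.dist_eq] using hst, by simpa [dist_eq_norm] using hJ.close_deriv s⟩)
    (Int.fract t) ⟨Int.fract_nonneg _, (Int.fract_lt_one _).le⟩
  have e1 : deriv K (Int.fract t) = deriv K t := by
    conv_rhs => rw [← Int.fract_add_floor t]
    exact (hK.deriv_add_int _ _).symm
  have e2 : deriv K (Int.fract t + (s - t)) = deriv K s := by
    rw [← hK.deriv_add_int _ ⌊t⌋]
    congr 1
    linarith [Int.fract_add_floor t]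
  simpa [e1, e2] using h1

/-- A nearby curve moves monotonically in the direction of the velocity of the given curve. -/
lemma exists_eq_of_planeInner_sub_eq_zero {K : ℝ → E3} (hK : IsSmoothLoop K)
    (him : ∀ t, proj (deriv K t) ≠ 0) :
    ∃ η > 0, ∀ J, IsNear K η J → ∀ s t, |s - t| < η →
      planeInner (J s - J t) (deriv K t) = 0 → s = t := by
  obtain ⟨η, hη, h⟩ := exists_planeInner_deriv_pos hK him
  refine ⟨η, hη, fun J hJ s t hst h0 => ?_⟩
  have hder : ∀ u, HasDerivAt (fun u => planeInner (J u) (deriv K t))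
      (planeInner (deriv J u) (deriv K t)) u := by
    intro u
    have hd : ∀ i, HasDerivAt (fun u => J u i) (deriv J u i) u := fun i =>
      (EuclideanSpace.proj (𝕜 := ℝ) i).hasFDerivAt.comp_hasDerivAt u
        (hJ.loop.differentiable u).hasDerivAt
    exact ((hd 0).mul_const _).add ((hd 1).mul_const _)
  have hmono : StrictMonoOn (fun u => planeInner (J u) (deriv K t)) (Metric.ball t η) := by
    refine strictMonoOn_of_deriv_pos (convex_ball _ _)
      (fun u _ => (hder u).continuousAt.continuousWithinAt) fun u hu => ?_
    rw [(hder u).deriv]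
    exact h J hJ u t (by simpa [Real.dist_eq] using interior_subset hu)
  refine hmono.injOn (by simpa [Real.dist_eq] using hst) (by simpa using hη) ?_
  simp only [planeInner, PiLp.sub_apply] at h0 ⊢
  linarith

/-- Along a blackboard framing, a push-off is displaced at right angles to the projection. -/
lemma IsPushOff.planeInner_sub {K V J : ℝ → E3} {δ : ℝ} (hV : IsBlackboardFraming K V)
    (hJ : IsPushOff K V δ J) (t : ℝ) : planeInner (J t - K t) (deriv K t) = 0 := by
  obtain ⟨r, -, hr⟩ := hJ.shift t
  have h := hV.normal t
  rw [PiLp.inner_apply, Fin.sum_univ_three] at h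
  simp only [RCLike.inner_apply, conj_trivial, hV.parallel t, mul_zero, add_zero] at h
  simp only [hr, add_sub_cancel_left, planeInner, PiLp.smul_apply, smul_eq_mul]
  linear_combination r * h

lemma IsPushOff.proj_ne {K V J : ℝ → E3} {δ : ℝ} (hV : IsBlackboardFraming K V)
    (hJ : IsPushOff K V δ J) (t : ℝ) : proj (J t) ≠ proj (K t) := by
  obtain ⟨r, hr0, hr⟩ := hJ.shift t
  intro h
  rw [hr, proj_eq_iff] at h
  simp only [PiLp.add_apply, PiLp.smul_apply, smul_eq_mul, add_eq_left, mul_eq_zero,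
    hr0.ne', false_or] at h
  exact hV.ne_zero t (ext_of_coords h.1 h.2 (hV.parallel t))

/-- Near the diagonal, the diagram of a knot and a small push-off along a blackboard framing has
no crossings. -/
lemma exists_eq_of_proj_eq {K V : ℝ → E3} (hK : IsSmoothLoop K)
    (him : ∀ t, proj (deriv K t) ≠ 0) (hV : IsBlackboardFraming K V) :
    ∃ η > 0, ∀ J, IsPushOff K V η J → ∀ (i j : Fin 2) (s t : ℝ) (n : ℤ), |s - t - n| < η →
      proj ((![K, J] : Fin 2 → ℝ → E3) i s) = proj ((![K, J] : Fin 2 → ℝ → E3) j t) →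
      i = j ∧ s = t + n := by
  obtain ⟨η, hη, h⟩ := exists_eq_of_planeInner_sub_eq_zero hK him
  refine ⟨η, hη, fun J hJ i j s t n hst heq => ?_⟩
  have hloop : ∀ k, IsSmoothLoop ((![K, J] : Fin 2 → ℝ → E3) k) := by
    intro k; fin_cases k; exacts [hK, hJ.loop]
  have hnear : ∀ k, IsNear K η ((![K, J] : Fin 2 → ℝ → E3) k) := by
    intro k; fin_cases k; exacts [hK.isNear_self hη, hJ.isNear]
  rw [← (hloop j).add_int t n] at heq
  obtain ⟨u, rfl⟩ : ∃ u, t = u - n := ⟨t + n, by ring⟩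
  simp only [sub_add_cancel] at heq ⊢
  replace hst : |s - u| < η := by rwa [show s - (u - n) - n = s - u by ring] at hst
  -- If `J u` lies over or under `K s`, then `K s - K u` is, like `J u - K u`, orthogonal to the
  -- velocity at `u` in the plane. Monotonicity forces `s = u`, contradicting the nonzero
  -- displacement.
  have mixed : ∀ s u, |s - u| < η → proj (K s) ≠ proj (J u) := by
    intro s u hst heq
    have := h K (hK.isNear_self hη) s u hst (by
      rw [← hJ.planeInner_sub hV u]
      simp only [planeInner, PiLp.sub_apply, (proj_eq_iff.1 heq).1, (proj_eq_iff.1 heq).2])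
    subst this
    exact hJ.proj_ne hV s heq.symm
  by_cases hij : i = j
  · subst hij
    refine ⟨rfl, h _ (hnear i) s u hst ?_⟩
    simp only [planeInner, PiLp.sub_apply, (proj_eq_iff.1 heq).1, (proj_eq_iff.1 heq).2, sub_self,
      zero_mul, add_zero]
  · exfalso
    fin_cases i <;> fin_cases j <;> simp at hij
    · exact mixed s u hst heq
    · exact mixed u s (by rwa [abs_sub_comm]) heq.symm

end NearDiagonal

/-! ### Existence of small push-offs. -/

section Existence

/-- Otherwise the horizontal vector `V t` would be both parallel and orthogonal to a nonzero planar
vector, hence zero. -/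
lemma planeDet_deriv_ne_zero {K V : ℝ → E3} (him : ∀ t, proj (deriv K t) ≠ 0)
    (hV : IsBlackboardFraming K V) (t : ℝ) : planeDet (deriv K t) (V t) ≠ 0 := by
  intro hd
  have h := hV.normal t
  rw [PiLp.inner_apply, Fin.sum_univ_three] at h
  simp only [RCLike.inner_apply, conj_trivial, hV.parallel t, mul_zero, add_zero] at h
  have hp := planeInner_self_pos (him t)
  unfold planeDet at hd
  unfold planeInner at hp
  refine hV.ne_zero t (ext_of_coords ?_ ?_ (hV.parallel t))
  · refine (mul_eq_zero.1 (?_ : _ * V t 0 = 0)).resolve_left hp.ne'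
    linear_combination deriv K t 0 * h - deriv K t 1 * hd
  · refine (mul_eq_zero.1 (?_ : _ * V t 1 = 0)).resolve_left hp.ne'
    linear_combination deriv K t 1 * h + deriv K t 0 * hd

/-- The velocity of `K` turned by a right angle in the blackboard. -/
noncomputable def planeNormal (K : ℝ → E3) (t : ℝ) : E3 := !₂[-deriv K t 1, deriv K t 0, 0]

lemma IsSmoothLoop.planeNormal {K : ℝ → E3} (hK : IsSmoothLoop K) :
    IsSmoothLoop (planeNormal K) where
  smooth := by
    have h := contDiff_euclidean.1 hK.contDiff_deriv
    refine contDiff_euclidean.2 fun i => ?_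
    fin_cases i
    · exact (h 1).neg
    · exact h 0
    · exact contDiff_const
  periodic t := by simp [BlackboardFraming.planeNormal, hK.periodic_deriv t]

lemma exists_norm_le_of_periodic {f : ℝ → E3} (hf : Continuous f)
    (hp : Function.Periodic f 1) : ∃ C > 0, ∀ t, ‖f t‖ ≤ C := by
  obtain ⟨C, hC⟩ := isCompact_Icc.exists_bound_of_continuousOn (s := Icc (0 : ℝ) 1) hf.continuousOn
  refine ⟨max C 1, by positivity, fun t => ?_⟩
  have := hC (Int.fract t) ⟨Int.fract_nonneg _, (Int.fract_lt_one _).le⟩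
  have e : f (Int.fract t) = f t := by
    conv_rhs => rw [← Int.fract_add_floor t]
    simpa using (hp.int_mul ⌊t⌋ (Int.fract t)).symm
  rw [e] at this
  exact this.trans (le_max_left _ _)

/-- As `V` is only continuous, `K + c • V` need not be smooth. The displacement used is instead a
constant multiple of the smooth field `planeNormal K`, which spans the same line as `V` at each
point. -/
lemma exists_isPushOff {K V : ℝ → E3} (hK : IsSmoothLoop K) (him : ∀ t, proj (deriv K t) ≠ 0)
    (hV : IsBlackboardFraming K V) {δ : ℝ} (hδ : 0 < δ) : ∃ J, IsPushOff K V δ J := by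
  -- The side of `K` on which `V` lies is constant, by the intermediate value theorem; `ε` records
  -- it.
  obtain ⟨ε, hε, hpos⟩ : ∃ ε : ℝ, |ε| = 1 ∧ ∀ t, 0 < ε * planeDet (deriv K t) (V t) := by
    have hne := planeDet_deriv_ne_zero him hV
    have hc : Continuous fun t => planeDet (deriv K t) (V t) :=
      continuous_planeDet.comp (hK.contDiff_deriv.continuous.prodMk hV.continuous)
    rcases lt_or_gt_of_ne (hne 0) with h0 | h0
    · refine ⟨-1, by simp, fun t => ?_⟩
      by_contra! hcon
      obtain ⟨x, hx⟩ := mem_range_of_exists_le_of_exists_ge hc (c := 0)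
        ⟨0, h0.le⟩ ⟨t, by linarith⟩
      exact hne x hx
    · refine ⟨1, by simp, fun t => ?_⟩
      by_contra! hcon
      obtain ⟨x, hx⟩ := mem_range_of_exists_le_of_exists_ge hc (c := 0)
        ⟨t, by linarith⟩ ⟨0, h0.le⟩
      exact hne x hx
  have hN := hK.planeNormal
  obtain ⟨C, hC0, hC⟩ := exists_norm_le_of_periodic hN.continuous hN.periodic
  obtain ⟨D, hD0, hD⟩ :=
    exists_norm_le_of_periodic hN.contDiff_deriv.continuous hN.periodic_deriv
  -- Both the normal field (bound `C`) and its derivative (bound `D`) are bounded by `C + D`, so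
  -- both displacements stay within `δ / 2`.
  set c : ℝ := δ / (2 * (C + D)) with hc
  have hc0 : 0 < c := by positivity
  have hcC : ∀ x ≤ C + D, c * x < δ := by
    intro x hx
    calc c * x ≤ c * (C + D) := by gcongr
      _ = δ / 2 := by rw [hc]; field_simp
      _ < δ := half_lt_self hδ
  have hnorm : ∀ x : E3, ‖x‖ ≤ C + D → ‖(c * ε) • x‖ < δ := by
    intro x hx
    rw [norm_smul, norm_mul, Real.norm_eq_abs, Real.norm_eq_abs, hε, abs_of_pos hc0, mul_one]
    exact hcC _ hx
  refine ⟨fun t => K t + (c * ε) • planeNormal K t, ⟨?_, ?_⟩, fun t => ?_, fun t => ?_, fun t => ?_⟩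
  · exact hK.smooth.add (hN.smooth.const_smul (c * ε))
  · intro t
    simp only [hK.periodic t, hN.periodic t]
  · have hd := hpos t
    -- Orthogonality of `V` and the velocity gives `planeDet (deriv K t) (V t) • planeNormal K t =
    -- planeInner (deriv K t) (deriv K t) • V t`; with `ε * ε = 1` this determines the coefficient.
    refine ⟨c * planeInner (deriv K t) (deriv K t) / (ε * planeDet (deriv K t) (V t)),
      div_pos (mul_pos hc0 (planeInner_self_pos (him t))) hd, ?_⟩
    have h := hV.normal t
    rw [PiLp.inner_apply, Fin.sum_univ_three] at h
    simp only [RCLike.inner_apply, conj_trivial, hV.parallel t, mul_zero, add_zero] at h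
    have hε2 : ε * ε = 1 := by rw [← abs_mul_abs_self, hε, one_mul]
    rw [add_right_inj]
    refine (smul_right_injective E3 hd.ne') ?_
    simp only
    rw [smul_smul _ _ (V t), mul_div_cancel₀ _ hd.ne', smul_smul]
    refine ext_of_coords ?_ ?_ ?_ <;>
      simp only [PiLp.smul_apply, smul_eq_mul, planeNormal, planeInner, planeDet, hV.parallel t]
    · simp only [Matrix.cons_val]
      linear_combination (-(c * (deriv K t 0 * V t 1 - deriv K t 1 * V t 0) * deriv K t 1)) * hε2
        - c * deriv K t 0 * h
    · simp only [Matrix.cons_val]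
      linear_combination (c * (deriv K t 0 * V t 1 - deriv K t 1 * V t 0) * deriv K t 0) * hε2
        - c * deriv K t 1 * h
    · simp
  · simpa using hnorm _ (by linarith [hC t])
  · have : deriv (fun t => K t + (c * ε) • planeNormal K t) t
        = deriv K t + (c * ε) • deriv (planeNormal K) t :=
      ((hK.differentiable t).hasDerivAt.add
        ((hN.differentiable t).hasDerivAt.const_smul (c * ε))).deriv
    rw [this]
    simpa using hnorm _ (by linarith [hD t])

end Existence

/-! ### Persistence of a transverse crossing, by a quantitative inverse function theorem. -/

section LocalCrossing

/-- The projection to the blackboard as a continuous linear map. -/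
noncomputable def projL : E3 →L[ℝ] EuclideanSpace ℝ (Fin 2) :=
  LinearMap.toContinuousLinearMap
    { toFun := proj
      map_add' := fun v w => by ext i; fin_cases i <;> simp [proj]
      map_smul' := fun c v => by ext i; fin_cases i <;> simp [proj] }

/-- The difference of the projections of two curves; its zeros are the crossings. -/
noncomputable def crossingMap (J J' : ℝ → E3) (q : ℝ × ℝ) : EuclideanSpace ℝ (Fin 2) :=
  projL (J q.1) - projL (J' q.2)

lemma crossingMap_eq_zero {J J' : ℝ → E3} {q : ℝ × ℝ} :
    crossingMap J J' q = 0 ↔ proj (J q.1) = proj (J' q.2) := sub_eq_zero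

lemma IsSmoothLoop.crossingMap_add_int {J J' : ℝ → E3} (hJ : IsSmoothLoop J)
    (hJ' : IsSmoothLoop J') (q : ℝ × ℝ) (m n : ℤ) :
    crossingMap J J' (q + ((m : ℝ), (n : ℝ))) = crossingMap J J' q := by
  simp [crossingMap, hJ.add_int, hJ'.add_int]

lemma IsNear.norm_sub_sub_le {K J : ℝ → E3} {δ : ℝ} (hK : IsSmoothLoop K) (hJ : IsNear K δ J)
    (s t : ℝ) : ‖(J s - K s) - (J t - K t)‖ ≤ δ * |s - t| := by
  refine Convex.norm_image_sub_le_of_norm_deriv_le (f := J - K) (s := univ)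
    (fun x _ => (hJ.loop.differentiable x).sub (hK.differentiable x)) (fun x _ => ?_)
    convex_univ (mem_univ _) (mem_univ _)
  rw [deriv_sub (hJ.loop.differentiable x) (hK.differentiable x)]
  exact (hJ.close_deriv x).le

/-- The crossing maps of nearby pairs of curves are close. -/
lemma norm_crossingMap_sub_le {K J J' : ℝ → E3} {δ : ℝ} (hJ : IsNear K δ J) (hJ' : IsNear K δ J')
    (q : ℝ × ℝ) : ‖crossingMap J J' q - crossingMap K K q‖ ≤ 2 * ‖projL‖ * δ := by
  have e : crossingMap J J' q - crossingMap K K q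
      = projL (J q.1 - K q.1) - projL (J' q.2 - K q.2) := by
    simp only [crossingMap, map_sub]; abel
  rw [e]
  calc _ ≤ ‖projL (J q.1 - K q.1)‖ + ‖projL (J' q.2 - K q.2)‖ := norm_sub_le _ _
    _ ≤ ‖projL‖ * δ + ‖projL‖ * δ := add_le_add
        (projL.le_opNorm_of_le (hJ.close _).le) (projL.le_opNorm_of_le (hJ'.close _).le)
    _ = _ := by ring

/-- Closeness of velocities makes the perturbation of the crossing map Lipschitz with a small
constant, which is the kind of error `ApproximatesLinearOn` can absorb. -/
lemma norm_crossingMap_sub_sub_le {K J J' : ℝ → E3} {δ : ℝ} (hK : IsSmoothLoop K)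
    (hJ : IsNear K δ J) (hJ' : IsNear K δ J') (p q : ℝ × ℝ) :
    ‖(crossingMap J J' p - crossingMap K K p) - (crossingMap J J' q - crossingMap K K q)‖
      ≤ 2 * ‖projL‖ * δ * ‖p - q‖ := by
  have hδ : 0 ≤ δ := (norm_nonneg _).trans (hJ.close 0).le
  have e : (crossingMap J J' p - crossingMap K K p) - (crossingMap J J' q - crossingMap K K q)
      = projL ((J p.1 - K p.1) - (J q.1 - K q.1))
        - projL ((J' p.2 - K p.2) - (J' q.2 - K q.2)) := by
    simp only [crossingMap, map_sub]; abel
  rw [e]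
  have h1 : ‖(J p.1 - K p.1) - (J q.1 - K q.1)‖ ≤ δ * ‖p - q‖ :=
    (hJ.norm_sub_sub_le hK _ _).trans (by gcongr; exact norm_fst_le (p - q))
  have h2 : ‖(J' p.2 - K p.2) - (J' q.2 - K q.2)‖ ≤ δ * ‖p - q‖ :=
    (hJ'.norm_sub_sub_le hK _ _).trans (by gcongr; exact norm_snd_le (p - q))
  calc _ ≤ _ := norm_sub_le _ _
    _ ≤ ‖projL‖ * (δ * ‖p - q‖) + ‖projL‖ * (δ * ‖p - q‖) :=
        add_le_add (projL.le_opNorm_of_le h1) (projL.le_opNorm_of_le h2)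
    _ = _ := by ring

/-- At a transverse crossing the crossing map has an invertible derivative. -/
lemma exists_hasStrictFDerivAt_crossingMap {K : ℝ → E3} (hK : IsSmoothLoop K) {p : ℝ × ℝ}
    (hdet : planeDet (deriv K p.1) (deriv K p.2) ≠ 0) :
    ∃ e : (ℝ × ℝ) ≃L[ℝ] EuclideanSpace ℝ (Fin 2),
      HasStrictFDerivAt (crossingMap K K) (e : ℝ × ℝ →L[ℝ] EuclideanSpace ℝ (Fin 2)) p := by
  have hs : ∀ t, HasStrictDerivAt K (deriv K t) t := fun t =>
    hK.smooth.contDiffAt.hasStrictDerivAt (by simp)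
  have h1 := (projL.hasStrictFDerivAt.comp p
    ((hs p.1).hasStrictFDerivAt.comp p hasStrictFDerivAt_fst)).sub
    (projL.hasStrictFDerivAt.comp p ((hs p.2).hasStrictFDerivAt.comp p hasStrictFDerivAt_snd))
  set A := projL.comp ((ContinuousLinearMap.toSpanSingleton ℝ (deriv K p.1)).comp
      (ContinuousLinearMap.fst ℝ ℝ ℝ))
    - projL.comp ((ContinuousLinearMap.toSpanSingleton ℝ (deriv K p.2)).comp
      (ContinuousLinearMap.snd ℝ ℝ ℝ)) with hA
  have hinj : Function.Injective (A : ℝ × ℝ →ₗ[ℝ] EuclideanSpace ℝ (Fin 2)) := by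
    refine (injective_iff_map_eq_zero _).2 fun v hv => ?_
    have hv' : proj (v.1 • deriv K p.1) = proj (v.2 • deriv K p.2) := sub_eq_zero.1 hv
    rw [proj_eq_iff] at hv'
    simp only [PiLp.smul_apply, smul_eq_mul] at hv'
    unfold planeDet at hdet
    refine Prod.ext ((mul_eq_zero.1 (?_ : v.1 * _ = 0)).resolve_right hdet)
      ((mul_eq_zero.1 (?_ : v.2 * _ = 0)).resolve_right hdet)
    · linear_combination deriv K p.2 1 * hv'.1 - deriv K p.2 0 * hv'.2
    · linear_combination deriv K p.1 1 * hv'.1 - deriv K p.1 0 * hv'.2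
  refine ⟨(LinearMap.linearEquivOfInjective _ hinj (by simp)).toContinuousLinearEquiv, ?_⟩
  convert! h1 using 1

/-- A transverse crossing persists, as a single transverse crossing, under small perturbations. -/
lemma eventually_exists_crossing {K : ℝ → E3} (hK : IsSmoothLoop K) {p : ℝ × ℝ}
    (h0 : crossingMap K K p = 0) (hdet : planeDet (deriv K p.1) (deriv K p.2) ≠ 0) :
    ∀ᶠ ρ in 𝓝[>] (0 : ℝ), ∀ᶠ δ in 𝓝[>] (0 : ℝ), ∀ J J', IsNear K δ J → IsNear K δ J' →
      (∃ q ∈ Metric.closedBall p ρ, crossingMap J J' q = 0) ∧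
        InjOn (crossingMap J J') (Metric.closedBall p (2 * ρ)) := by
  obtain ⟨e, he⟩ := exists_hasStrictFDerivAt_crossingMap hK hdet
  have hN : 0 < ‖(e.symm : EuclideanSpace ℝ (Fin 2) →L[ℝ] ℝ × ℝ)‖₊ :=
    e.subsingleton_or_nnnorm_symm_pos.resolve_left (not_subsingleton _)
  set N := ‖(e.symm : EuclideanSpace ℝ (Fin 2) →L[ℝ] ℝ × ℝ)‖₊ with hNdef
  -- Linear approximation within `N⁻¹ / 2` suffices for injectivity and surjectivity; half of this
  -- is left for the perturbation.
  have hc : 0 < N⁻¹ / 4 := by positivity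
  obtain ⟨U, hU, happ⟩ := he.approximates_deriv_on_nhds (Or.inr hc)
  obtain ⟨r, hr, hrU⟩ := Metric.nhds_basis_closedBall.mem_iff.1 hU
  filter_upwards [Ioo_mem_nhdsGT (half_pos hr)] with ρ hρ
  have hsmall : ∀ x : ℝ, 0 < x → ∀ᶠ δ in 𝓝[>] (0 : ℝ), 2 * ‖projL‖ * δ < x := by
    intro x hx
    have : Tendsto (fun δ : ℝ => 2 * ‖projL‖ * δ) (𝓝[>] 0) (𝓝 0) := by
      have : Tendsto (fun δ : ℝ => 2 * ‖projL‖ * δ) (𝓝 0) (𝓝 (2 * ‖projL‖ * 0)) :=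
        (continuous_const.mul continuous_id).tendsto 0
      simpa using this.mono_left nhdsWithin_le_nhds
    exact this.eventually (gt_mem_nhds hx)
  have hρ0 : 0 < ρ := hρ.1
  filter_upwards [hsmall (N⁻¹ / 4 : NNReal) (by exact_mod_cast hc),
    hsmall ((N⁻¹ / 4 : NNReal) * ρ) (by positivity)] with δ h1 h2 J J' hJ hJ'
  have happ' : ApproximatesLinearOn (crossingMap J J')
      (e : ℝ × ℝ →L[ℝ] EuclideanSpace ℝ (Fin 2)) (Metric.closedBall p (2 * ρ)) (N⁻¹ / 2) := by
    intro x hx y hy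
    have hsub : Metric.closedBall p (2 * ρ) ⊆ U :=
      (Metric.closedBall_subset_closedBall (by linarith [hρ.2])).trans hrU
    have a1 := happ x (hsub hx) y (hsub hy)
    have a2 := norm_crossingMap_sub_sub_le hK hJ hJ' x y
    calc ‖crossingMap J J' x - crossingMap J J' y
          - (e : ℝ × ℝ →L[ℝ] EuclideanSpace ℝ (Fin 2)) (x - y)‖
        = ‖(crossingMap K K x - crossingMap K K y
          - (e : ℝ × ℝ →L[ℝ] EuclideanSpace ℝ (Fin 2)) (x - y))
          + ((crossingMap J J' x - crossingMap K K x)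
            - (crossingMap J J' y - crossingMap K K y))‖ := by congr 1; abel
      _ ≤ _ := norm_add_le _ _
      _ ≤ (N⁻¹ / 4 : NNReal) * ‖x - y‖ + (N⁻¹ / 4 : NNReal) * ‖x - y‖ :=
          add_le_add a1 (a2.trans (by gcongr))
      _ = (N⁻¹ / 2 : NNReal) * ‖x - y‖ := by push_cast; ring
  refine ⟨?_, happ'.injOn (Or.inr (NNReal.half_lt_self (by positivity)))⟩
  -- The image of the `ρ`-ball contains the ball of radius `(N⁻¹ - N⁻¹ / 2) * ρ` about `crossingMap
  -- J J' p`, a value within `N⁻¹ / 4 * ρ` of zero.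
  have hsurj := happ'.surjOn_closedBall_of_nonlinearRightInverse
    e.toNonlinearRightInverse hρ0.le
    (Metric.closedBall_subset_closedBall (by linarith : ρ ≤ 2 * ρ))
  obtain ⟨q, hq, hq0⟩ := hsurj (a := 0) (by
    rw [Metric.mem_closedBall, dist_comm, dist_zero_right]
    have := norm_crossingMap_sub_le hJ hJ' p
    rw [h0, sub_zero] at this
    refine (this.trans h2.le).trans ?_
    change _ ≤ ((N : ℝ)⁻¹ - (N⁻¹ / 2 : NNReal)) * ρ
    have hNr : (0 : ℝ) < (N : ℝ)⁻¹ := by positivity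
    push_cast
    gcongr
    linarith)
  exact ⟨q, hq, hq0⟩

end LocalCrossing

/-! ### Local constancy of crossing signs. -/

section LocalSign

lemma planeDet_comm (v w : E3) : planeDet w v = -planeDet v w := by
  unfold planeDet; ring

lemma crossingSign_eq_of_sign_eq {J J' K K' : ℝ → E3} {s t s' t' : ℝ}
    (hdet : SignType.sign (planeDet (deriv J s) (deriv J' t))
      = SignType.sign (planeDet (deriv K s') (deriv K' t')))
    (hz : SignType.sign (J s 2 - J' t 2) = SignType.sign (K s' 2 - K' t' 2)) :
    crossingSign J J' s t = crossingSign K K' s' t' := by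
  have h : J' t 2 < J s 2 ↔ K' t' 2 < K s' 2 := by
    rw [← sub_pos, ← sign_eq_one_iff, hz, sign_eq_one_iff, sub_pos]
  simp only [crossingSign, h, planeDet_comm (deriv J s), planeDet_comm (deriv K s'),
    Left.sign_neg, hdet]

/-- The sign orders the strands by height and not by their listing. At equal heights both sides
would use the `else` branch, with opposite determinants. -/
lemma crossingSign_comm {K : ℝ → E3} {s t : ℝ} (h : K s 2 ≠ K t 2) :
    crossingSign K K s t = crossingSign K K t s := by
  unfold crossingSign
  rcases lt_or_gt_of_ne h with h | h <;> simp [h, h.le, not_lt_of_ge]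

lemma eventually_sign_eq {X : Type*} [TopologicalSpace X] {f : X → ℝ} (hf : Continuous f) {x : X}
    (hx : f x ≠ 0) : ∀ᶠ y in 𝓝 x, SignType.sign (f y) = SignType.sign (f x) := by
  have : ContinuousAt (fun y => SignType.sign (f y)) x :=
    (continuousAt_sign_of_ne_zero hx).comp hf.continuousAt
  exact (this.eventually (mem_nhds_discrete.2 rfl)).mono fun _ h => Eq.symm h

/-- The sign of a crossing and the order of its strands do not change under small perturbations. -/
lemma eventually_crossingSign_eq {K : ℝ → E3} (hK : IsSmoothLoop K) {p : ℝ × ℝ}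
    (hdet : planeDet (deriv K p.1) (deriv K p.2) ≠ 0) (hz : K p.1 2 ≠ K p.2 2) :
    ∀ᶠ ρ in 𝓝[>] (0 : ℝ), ∀ᶠ δ in 𝓝[>] (0 : ℝ), ∀ J J', IsNear K δ J → IsNear K δ J' →
      ∀ q ∈ Metric.closedBall p ρ, planeDet (deriv J q.1) (deriv J' q.2) ≠ 0 ∧
        J q.1 2 ≠ J' q.2 2 ∧ crossingSign J J' q.1 q.2 = crossingSign K K p.1 p.2 := by
  have hsign := (eventually_sign_eq (X := (E3 × E3) × (E3 × E3))
    (f := fun x => planeDet x.1.1 x.1.2) (continuous_planeDet.comp continuous_fst)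
    (x := ((deriv K p.1, deriv K p.2), (K p.1, K p.2))) hdet).and
    (eventually_sign_eq (X := (E3 × E3) × (E3 × E3)) (f := fun x => x.2.1 2 - x.2.2 2)
      (by fun_prop) (x := ((deriv K p.1, deriv K p.2), (K p.1, K p.2))) (sub_ne_zero.2 hz))
  obtain ⟨ε, hε, hball⟩ := Metric.eventually_nhds_iff.1 hsign
  -- Half of `ε` pays for moving along `K` from `p` to `q`, the other half for replacing `K` by `J`
  -- and `J'`.
  have hcont : ∀ᶠ q in 𝓝 p, dist (((deriv K q.1, deriv K q.2), (K q.1, K q.2)) :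
      (E3 × E3) × (E3 × E3)) ((deriv K p.1, deriv K p.2), (K p.1, K p.2)) < ε / 2 := by
    have h1 := hK.continuous
    have h2 := hK.contDiff_deriv.continuous
    have : Continuous fun q : ℝ × ℝ => (((deriv K q.1, deriv K q.2), (K q.1, K q.2)) :
      (E3 × E3) × (E3 × E3)) := by fun_prop
    exact this.continuousAt.eventually (Metric.ball_mem_nhds _ (half_pos hε))
  obtain ⟨r, hr, hrU⟩ := Metric.nhds_basis_closedBall.mem_iff.1 hcont
  filter_upwards [Ioo_mem_nhdsGT hr] with ρ hρ
  filter_upwards [Ioo_mem_nhdsGT (half_pos hε)] with δ hδ J J' hJ hJ' q hq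
  have hd : dist (((deriv J q.1, deriv J' q.2), (J q.1, J' q.2)) : (E3 × E3) × (E3 × E3))
      ((deriv K q.1, deriv K q.2), (K q.1, K q.2)) < ε / 2 := by
    simp only [Prod.dist_eq, max_lt_iff]
    simp only [dist_eq_norm]
    exact ⟨⟨(hJ.close_deriv _).trans hδ.2, (hJ'.close_deriv _).trans hδ.2⟩,
      (hJ.close _).trans hδ.2, (hJ'.close _).trans hδ.2⟩
  obtain ⟨s1, s2⟩ := hball ((dist_triangle _ _ _).trans_lt (add_lt_add hd
    (hrU (Metric.closedBall_subset_closedBall hρ.2.le hq))) |>.trans_eq (add_halves ε))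
  simp only at s1 s2
  refine ⟨?_, ?_, crossingSign_eq_of_sign_eq s1 s2⟩
  · rwa [← sign_ne_zero, s1, sign_ne_zero]
  · rwa [← sub_ne_zero, ← sign_ne_zero, s2, sign_ne_zero, sub_ne_zero]

end LocalSign

/-! ### Crossings modulo integer shifts of the parameters. -/

section Diagram

lemma mk_fract_fract_add (q : ℝ × ℝ) :
    (Int.fract q.1, Int.fract q.2) + ((⌊q.1⌋ : ℝ), (⌊q.2⌋ : ℝ)) = q :=
  Prod.ext (Int.fract_add_floor _) (Int.fract_add_floor _)

lemma fract_mem_Ico (t : ℝ) : Int.fract t ∈ Ico (0 : ℝ) 1 := ⟨Int.fract_nonneg _, Int.fract_lt_one _⟩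

lemma IsSmoothLoop.apply_fract {K : ℝ → E3} (hK : IsSmoothLoop K) (t : ℝ) :
    K (Int.fract t) = K t := by
  conv_rhs => rw [← Int.fract_add_floor t]
  exact (hK.add_int _ _).symm

lemma IsSmoothLoop.deriv_fract {K : ℝ → E3} (hK : IsSmoothLoop K) (t : ℝ) :
    deriv K (Int.fract t) = deriv K t := by
  conv_rhs => rw [← Int.fract_add_floor t]
  exact (hK.deriv_add_int _ _).symm

lemma crossingMap_fract {J J' : ℝ → E3} (hJ : IsSmoothLoop J) (hJ' : IsSmoothLoop J')
    (q : ℝ × ℝ) : crossingMap J J' (Int.fract q.1, Int.fract q.2) = crossingMap J J' q := by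
  simp only [crossingMap, hJ.apply_fract, hJ'.apply_fract]

lemma crossingSign_fract {J J' : ℝ → E3} (hJ : IsSmoothLoop J) (hJ' : IsSmoothLoop J')
    (s t : ℝ) : crossingSign J J' (Int.fract s) (Int.fract t) = crossingSign J J' s t := by
  simp only [crossingSign, hJ.apply_fract, hJ'.apply_fract, hJ.deriv_fract, hJ'.deriv_fract]

/-- The parameter `s` differs from `t` on the circle `ℝ / ℤ`. -/
def CircleNe (s t : ℝ) : Prop := ∀ n : ℤ, s ≠ t + n

lemma CircleNe.fract_ne {s t : ℝ} (h : CircleNe s t) : Int.fract s ≠ Int.fract t := by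
  intro he
  obtain ⟨z, hz⟩ := Int.fract_eq_fract.1 he
  exact h z (by linarith)

lemma circleNe_of_fract_ne {s t : ℝ} (h : Int.fract s ≠ Int.fract t) : CircleNe s t := by
  rintro n rfl
  exact h (by simp)

lemma circleNe_of_ne {s t : ℝ} (hs : s ∈ Ico (0 : ℝ) 1) (ht : t ∈ Ico (0 : ℝ) 1) (h : s ≠ t) :
    CircleNe s t :=
  circleNe_of_fract_ne (by rwa [Int.fract_eq_self.2 hs, Int.fract_eq_self.2 ht])

/-- The crossings of two strands with distinct parameters, each listed by its parameters
in `[0, 1)`. -/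
def crossings (J J' : ℝ → E3) : Set (ℝ × ℝ) :=
  {q | q.1 ∈ Ico (0 : ℝ) 1 ∧ q.2 ∈ Ico (0 : ℝ) 1 ∧ q.1 ≠ q.2 ∧ crossingMap J J' q = 0}

lemma fract_mem_crossings {J J' : ℝ → E3} (hJ : IsSmoothLoop J) (hJ' : IsSmoothLoop J')
    {q : ℝ × ℝ} (hne : CircleNe q.1 q.2) (h : crossingMap J J' q = 0) :
    (Int.fract q.1, Int.fract q.2) ∈ crossings J J' :=
  ⟨fract_mem_Ico _, fract_mem_Ico _, hne.fract_ne, by rwa [crossingMap_fract hJ hJ']⟩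

lemma mem_doublePoints_of_mem_crossings {K : ℝ → E3} {q : ℝ × ℝ} (hq : q ∈ crossings K K) :
    ((((), q.1), ((), q.2)) : (Unit × ℝ) × (Unit × ℝ)) ∈ doublePoints fun _ : Unit => K :=
  ⟨hq.1, hq.2.1, fun h => hq.2.2.1 (Prod.ext_iff.1 h).2, crossingMap_eq_zero.1 hq.2.2.2⟩

namespace IsKnotDiagram

variable {K : ℝ → E3} (hK : IsKnotDiagram K)
include hK

lemma isKnot : IsKnot K := hK.link.knot ()

lemma isSmoothLoop : IsSmoothLoop K := hK.isKnot.toIsSmoothLoop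

lemma finite_crossings : (crossings K K).Finite := by
  refine Set.Finite.of_injOn (f := fun q : ℝ × ℝ => (((), q.1), ((), q.2)))
    (fun q hq => mem_doublePoints_of_mem_crossings hq) ?_ hK.finite
  intro q _ q' _ h
  simp only [Prod.mk.injEq, true_and] at h
  exact Prod.ext h.1 h.2

lemma planeDet_ne_zero {q : ℝ × ℝ} (hq : q ∈ crossings K K) :
    planeDet (deriv K q.1) (deriv K q.2) ≠ 0 :=
  hK.transverse _ (mem_doublePoints_of_mem_crossings hq)

/-- Equal heights would make the two strands meet in space. -/
lemma height_ne {q : ℝ × ℝ} (hq : q ∈ crossings K K) : K q.1 2 ≠ K q.2 2 := by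
  intro h
  have := proj_eq_iff.1 (crossingMap_eq_zero.1 hq.2.2.2)
  exact hq.2.2.1 (hK.isKnot.injective hq.1 hq.2.1 (ext_of_coords this.1 this.2 h))

/-- Fractional parts carry the `double` condition, stated on `[0, 1)`, to arbitrary real parameters.
-/
lemma no_triple_points {s t u : ℝ} (hst : CircleNe s t) (hsu : CircleNe s u) (htu : CircleNe t u)
    (h : proj (K s) = proj (K t)) : proj (K s) ≠ proj (K u) := by
  intro h'
  have hs := hK.isSmoothLoop
  have h1 := mem_doublePoints_of_mem_crossings
    (fract_mem_crossings hs hs (q := (s, t)) hst (crossingMap_eq_zero.2 h))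
  have h2 := mem_doublePoints_of_mem_crossings
    (fract_mem_crossings hs hs (q := (s, u)) hsu (crossingMap_eq_zero.2 h'))
  exact htu.fract_ne (Prod.ext_iff.1 (hK.double _ _ _ h1 h2)).2

end IsKnotDiagram

end Diagram

/-! ### Global control of crossings and triple points by compactness. -/

section Compactness

/-- On a compact set, the approximate zeros of a continuous function are close to its zeros. -/
lemma exists_pos_of_zero_mem {X : Type*} [TopologicalSpace X] {C U : Set X} (hC : IsCompact C)
    (hU : IsOpen U) {f : X → ℝ} (hf : Continuous f) (h : ∀ x ∈ C, f x = 0 → x ∈ U) :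
    ∃ c > 0, ∀ x ∈ C, |f x| < c → x ∈ U := by
  rcases (C \ U).eq_empty_or_nonempty with he | hne
  · exact ⟨1, one_pos, fun x hx _ => sdiff_eq_empty.1 he hx⟩
  · obtain ⟨x₀, hx₀, hmin⟩ := (hC.diff hU).exists_isMinOn hne hf.abs.continuousOn
    refine ⟨|f x₀|, abs_pos.2 fun h0 => hx₀.2 (h x₀ hx₀.1 h0), fun x hx hlt => ?_⟩
    by_contra hxU
    exact (hmin ⟨hx, hxU⟩).not_gt hlt

lemma isOpen_exists_abs_sub_lt {X : Type*} [TopologicalSpace X] {f : X → ℝ} (hf : Continuous f)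
    (η : ℝ) : IsOpen {x | ∃ n : ℤ, |f x - n| < η} := by
  simp only [ofPred_exists]
  exact isOpen_iUnion fun n => isOpen_lt (by fun_prop) continuous_const

lemma exists_abs_sub_lt_of_fract {s t η : ℝ} (h : ∃ n : ℤ, |Int.fract s - Int.fract t - n| < η) :
    ∃ n : ℤ, |s - t - n| < η := by
  obtain ⟨n, hn⟩ := h
  refine ⟨n + ⌊s⌋ - ⌊t⌋, ?_⟩
  convert hn using 2
  push_cast
  unfold Int.fract
  ring

lemma exists_abs_sub_lt_of_not_circleNe {s t η : ℝ} (hη : 0 < η) (h : ¬CircleNe s t) :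
    ∃ n : ℤ, |s - t - n| < η := by
  simp only [CircleNe, not_forall, not_not] at h
  obtain ⟨n, rfl⟩ := h
  exact ⟨n, by simpa using hη⟩

/-- Turns crossings of nearby curves into approximate zeros for `K`, the input of
`exists_pos_of_zero_mem`. -/
lemma eventually_norm_proj_sub_lt (K : ℝ → E3) {c : ℝ} (hc : 0 < c) :
    ∀ᶠ δ in 𝓝[>] (0 : ℝ), ∀ J J', IsNear K δ J → IsNear K δ J' → ∀ q : ℝ × ℝ,
      crossingMap J J' q = 0 → ‖crossingMap K K q‖ < c := by
  have : Tendsto (fun δ : ℝ => 2 * ‖projL‖ * δ) (𝓝[>] 0) (𝓝 0) := by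
    have : Tendsto (fun δ : ℝ => 2 * ‖projL‖ * δ) (𝓝 0) (𝓝 (2 * ‖projL‖ * 0)) :=
      (continuous_const.mul continuous_id).tendsto 0
    simpa using this.mono_left nhdsWithin_le_nhds
  filter_upwards [this.eventually (gt_mem_nhds hc)] with δ hδ J J' hJ hJ' q hq
  have := norm_crossingMap_sub_le hJ hJ' q
  rw [hq, zero_sub, norm_neg] at this
  exact this.trans_lt hδ

lemma IsSmoothLoop.continuous_crossingMap {J J' : ℝ → E3} (hJ : IsSmoothLoop J)
    (hJ' : IsSmoothLoop J') : Continuous (crossingMap J J') := by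
  have h1 := hJ.continuous
  have h2 := hJ'.continuous
  unfold crossingMap
  fun_prop

/-- Away from the diagonal, crossings of small perturbations are close to crossings. -/
lemma eventually_exists_crossing_near {K : ℝ → E3} (hK : IsSmoothLoop K) {η ρ : ℝ} (hη : 0 < η)
    (hρ : 0 < ρ) :
    ∀ᶠ δ in 𝓝[>] (0 : ℝ), ∀ J J', IsNear K δ J → IsNear K δ J' → ∀ q : ℝ × ℝ,
      crossingMap J J' q = 0 → (∃ n : ℤ, |q.1 - q.2 - n| < η) ∨
        ∃ p, CircleNe p.1 p.2 ∧ crossingMap K K p = 0 ∧ dist q p < ρ := by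
  -- Crossings are taken over the whole plane, not only `[0, 1)²`, so that zeros on the sides of the
  -- closed square where a parameter is `1` are covered too.
  set P : Set (ℝ × ℝ) := {p | CircleNe p.1 p.2 ∧ crossingMap K K p = 0} with hP
  have hopen : IsOpen ({q : ℝ × ℝ | ∃ n : ℤ, |q.1 - q.2 - n| < η} ∪ ⋃ p ∈ P, Metric.ball p ρ) :=
    (isOpen_exists_abs_sub_lt (continuous_fst.sub continuous_snd) η).union
      (isOpen_biUnion fun _ _ => Metric.isOpen_ball)
  obtain ⟨c, hc, h⟩ := exists_pos_of_zero_mem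
    (isCompact_Icc.prod isCompact_Icc : IsCompact (Icc (0 : ℝ) 1 ×ˢ Icc (0 : ℝ) 1)) hopen
    (hK.continuous_crossingMap hK).norm (by
      intro q _ hq
      rw [norm_eq_zero] at hq
      by_cases hne : CircleNe q.1 q.2
      · exact Or.inr (mem_biUnion (x := q) ⟨hne, hq⟩ (Metric.mem_ball_self hρ))
      · exact Or.inl (exists_abs_sub_lt_of_not_circleNe hη hne))
  filter_upwards [eventually_norm_proj_sub_lt K hc] with δ hδ J J' hJ hJ' q hq
  have hlt := hδ J J' hJ hJ' q hq
  rw [← crossingMap_fract hK hK, ← abs_norm] at hlt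
  rcases h (Int.fract q.1, Int.fract q.2) ⟨Ico_subset_Icc_self (fract_mem_Ico _),
    Ico_subset_Icc_self (fract_mem_Ico _)⟩ hlt with h' | h'
  · exact Or.inl (exists_abs_sub_lt_of_fract h')
  · obtain ⟨p, hp, hd⟩ := mem_iUnion₂.1 h'
    refine Or.inr ⟨p + ((⌊q.1⌋ : ℝ), (⌊q.2⌋ : ℝ)), ?_, ?_, ?_⟩
    · intro n hn
      refine hp.1 (n + ⌊q.2⌋ - ⌊q.1⌋) ?_
      simp only [Prod.fst_add, Prod.snd_add] at hn
      push_cast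
      linarith
    · rw [hK.crossingMap_add_int hK]; exact hp.2
    · refine Eq.trans_lt ?_ hd
      conv_lhs => enter [1]; rw [← mk_fract_fract_add q]
      exact dist_add_right _ _ _

/-- Small perturbations of a knot diagram have no triple points away from the diagonal. -/
lemma IsKnotDiagram.eventually_no_triple_points {K : ℝ → E3} (hK : IsKnotDiagram K) {η : ℝ}
    (hη : 0 < η) :
    ∀ᶠ δ in 𝓝[>] (0 : ℝ), ∀ J₁ J₂ J₃, IsNear K δ J₁ → IsNear K δ J₂ → IsNear K δ J₃ →
      ∀ s t u, proj (J₁ s) = proj (J₂ t) → proj (J₁ s) = proj (J₃ u) →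
        (∃ n : ℤ, |s - t - n| < η) ∨ (∃ n : ℤ, |s - u - n| < η) ∨ ∃ n : ℤ, |t - u - n| < η := by
  have hs := hK.isSmoothLoop
  have hcK := hs.continuous_crossingMap hs
  have hopen : IsOpen ({q : ℝ × ℝ × ℝ | ∃ n : ℤ, |q.1 - q.2.1 - n| < η} ∪
      ({q : ℝ × ℝ × ℝ | ∃ n : ℤ, |q.1 - q.2.2 - n| < η} ∪
      {q : ℝ × ℝ × ℝ | ∃ n : ℤ, |q.2.1 - q.2.2 - n| < η})) :=
    (isOpen_exists_abs_sub_lt (by fun_prop) η).union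
      ((isOpen_exists_abs_sub_lt (by fun_prop) η).union
        (isOpen_exists_abs_sub_lt (by fun_prop) η))
  obtain ⟨c, hc, h⟩ := exists_pos_of_zero_mem
    (isCompact_Icc.prod (isCompact_Icc.prod isCompact_Icc) :
      IsCompact (Icc (0 : ℝ) 1 ×ˢ Icc (0 : ℝ) 1 ×ˢ Icc (0 : ℝ) 1)) hopen
    -- A sum of norms encodes both coincidences as zeros of one real function.
    (f := fun q => ‖crossingMap K K (q.1, q.2.1)‖ + ‖crossingMap K K (q.1, q.2.2)‖)
    (by fun_prop) (by
      intro q _ hq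
      have h1 : crossingMap K K (q.1, q.2.1) = 0 := by
        rw [← norm_eq_zero]; linarith [norm_nonneg (crossingMap K K (q.1, q.2.1)),
          norm_nonneg (crossingMap K K (q.1, q.2.2))]
      have h2 : crossingMap K K (q.1, q.2.2) = 0 := by
        rw [← norm_eq_zero]; linarith [norm_nonneg (crossingMap K K (q.1, q.2.1)),
          norm_nonneg (crossingMap K K (q.1, q.2.2))]
      by_contra hcon
      simp only [mem_union, mem_ofPred_eq, not_or] at hcon
      have ne : ∀ {s t : ℝ}, (¬∃ n : ℤ, |s - t - n| < η) → CircleNe s t := fun hn => by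
        by_contra hne
        exact hn (exists_abs_sub_lt_of_not_circleNe hη hne)
      exact hK.no_triple_points (ne hcon.1) (ne hcon.2.1) (ne hcon.2.2)
        (crossingMap_eq_zero.1 h1) (crossingMap_eq_zero.1 h2))
  filter_upwards [eventually_norm_proj_sub_lt K (half_pos hc)]
    with δ hδ J₁ J₂ J₃ h₁ h₂ h₃ s t u hst hsu
  have e1 := hδ J₁ J₂ h₁ h₂ (s, t) (crossingMap_eq_zero.2 hst)
  have e2 := hδ J₁ J₃ h₁ h₃ (s, u) (crossingMap_eq_zero.2 hsu)
  rw [← crossingMap_fract hs hs] at e1 e2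
  rcases h (Int.fract s, Int.fract t, Int.fract u)
    ⟨Ico_subset_Icc_self (fract_mem_Ico _), Ico_subset_Icc_self (fract_mem_Ico _),
      Ico_subset_Icc_self (fract_mem_Ico _)⟩
    (by rw [abs_of_nonneg (by positivity)]; exact (add_lt_add e1 e2).trans_eq (add_halves c))
    with h' | h' | h'
  · exact Or.inl (exists_abs_sub_lt_of_fract h')
  · exact Or.inr (Or.inl (exists_abs_sub_lt_of_fract h'))
  · exact Or.inr (Or.inr (exists_abs_sub_lt_of_fract h'))

end Compactness

/-! ### Sign-preserving correspondence of crossings. -/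

section Bijection

lemma eventually_circleNe {p : ℝ × ℝ} (hp : CircleNe p.1 p.2) :
    ∀ᶠ ρ in 𝓝[>] (0 : ℝ), ∀ q ∈ Metric.closedBall p ρ, CircleNe q.1 q.2 := by
  have hU : (fun q : ℝ × ℝ => q.1 - q.2) ⁻¹' (range ((↑) : ℤ → ℝ))ᶜ ∈ 𝓝 p := by
    refine (Int.isClosedEmbedding_coe_real.isClosed_range.isOpen_compl.preimage
      (by fun_prop)).mem_nhds ?_
    rintro ⟨n, hn⟩
    exact hp n (by simp only at hn; linarith)
  obtain ⟨r, hr, hrU⟩ := Metric.nhds_basis_closedBall.mem_iff.1 hU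
  filter_upwards [Ioo_mem_nhdsGT hr] with ρ hρ q hq n hn
  exact hrU (Metric.closedBall_subset_closedBall hρ.2.le hq) ⟨n, by simp only [hn]; ring⟩

/-- The crossings of two curves close to a knot diagram correspond to the crossings of the
diagram, with the same signs. -/
lemma IsKnotDiagram.eventually_exists_bijOn {K : ℝ → E3} (hK : IsKnotDiagram K) {η : ℝ}
    (hη : 0 < η) :
    ∀ᶠ δ in 𝓝[>] (0 : ℝ), ∀ J J', IsNear K δ J → IsNear K δ J' →
      (∀ (s t : ℝ) (n : ℤ), |s - t - n| < η → proj (J s) = proj (J' t) → s = t + n) →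
      ∃ g : ℝ × ℝ → ℝ × ℝ, BijOn g (crossings K K) (crossings J J') ∧
        ∀ p ∈ crossings K K, planeDet (deriv J (g p).1) (deriv J' (g p).2) ≠ 0 ∧
          J (g p).1 2 ≠ J' (g p).2 2 ∧
          crossingSign K K p.1 p.2 = crossingSign J J' (g p).1 (g p).2 := by
  have hs := hK.isSmoothLoop
  have hloc : ∀ᶠ ρ in 𝓝[>] (0 : ℝ), 0 < ρ ∧ ∀ p ∈ crossings K K,
      (∀ q ∈ Metric.closedBall p ρ, CircleNe q.1 q.2) ∧
      (∀ᶠ δ in 𝓝[>] (0 : ℝ), ∀ J J', IsNear K δ J → IsNear K δ J' →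
        (∃ q ∈ Metric.closedBall p ρ, crossingMap J J' q = 0) ∧
          InjOn (crossingMap J J') (Metric.closedBall p (2 * ρ))) ∧
      (∀ᶠ δ in 𝓝[>] (0 : ℝ), ∀ J J', IsNear K δ J → IsNear K δ J' →
        ∀ q ∈ Metric.closedBall p ρ, planeDet (deriv J q.1) (deriv J' q.2) ≠ 0 ∧
          J q.1 2 ≠ J' q.2 2 ∧ crossingSign J J' q.1 q.2 = crossingSign K K p.1 p.2) := by
    refine Eventually.and self_mem_nhdsWithin
      ((eventually_all_finite hK.finite_crossings).2 fun p hp => ?_)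
    exact (eventually_circleNe (circleNe_of_ne hp.1 hp.2.1 hp.2.2.1)).and
      ((eventually_exists_crossing hs hp.2.2.2 (hK.planeDet_ne_zero hp)).and
        (eventually_crossingSign_eq hs (hK.planeDet_ne_zero hp) (hK.height_ne hp)))
  -- Finiteness of the crossings allows one `ρ` for all of them; `δ` is chosen only afterwards,
  -- depending on `ρ`.
  obtain ⟨ρ, hρ, hloc⟩ := hloc.exists
  filter_upwards [self_mem_nhdsWithin, eventually_exists_crossing_near hs hη hρ,
    (eventually_all_finite hK.finite_crossings).2 fun p hp => (hloc p hp).2.1,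
    (eventually_all_finite hK.finite_crossings).2 fun p hp => (hloc p hp).2.2]
    with δ hδ hnear hcross hsign J J' hJ hJ' hdiag
  choose! c hc hc0 using fun p hp => (hcross p hp J J' hJ hJ').1
  have hdouble : ∀ p : ℝ × ℝ, Metric.closedBall p ρ ⊆ Metric.closedBall p (2 * ρ) := fun p =>
    Metric.closedBall_subset_closedBall (by linarith)
  -- The perturbed crossing `c p` may leave `[0, 1)²` when `p` lies on its edge, hence the
  -- fractional parts.
  refine ⟨fun p => (Int.fract (c p).1, Int.fract (c p).2), ⟨?_, ?_, ?_⟩, ?_⟩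
  · exact fun p hp =>
      fract_mem_crossings hJ.loop hJ'.loop ((hloc p hp).1 _ (hc p hp)) (hc0 p hp)
  · intro p hp p' hp' h
    obtain ⟨m, hm⟩ := Int.fract_eq_fract.1 (Prod.ext_iff.1 h).1
    obtain ⟨n, hn⟩ := Int.fract_eq_fract.1 (Prod.ext_iff.1 h).2
    have hshift : c p' + ((m : ℝ), (n : ℝ)) = c p :=
      Prod.ext (by simp only [Prod.fst_add]; linarith) (by simp only [Prod.snd_add]; linarith)
    -- Two radii add up here, which is why injectivity is required on the `2 * ρ`-ball; it is
    -- applied to `K` itself.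
    have hmem : p' + ((m : ℝ), (n : ℝ)) ∈ Metric.closedBall p (2 * ρ) := by
      have h1 : dist (p' + ((m : ℝ), (n : ℝ))) (c p) ≤ ρ := by
        rw [← hshift, dist_add_right, dist_comm]; exact hc p' hp'
      have h2 : dist (c p) p ≤ ρ := hc p hp
      exact (dist_triangle _ _ _).trans (by linarith)
    have heq := (hcross p hp K K (hs.isNear_self hδ) (hs.isNear_self hδ)).2
      (Metric.mem_closedBall_self (by positivity)) hmem
      (by rw [hs.crossingMap_add_int hs, hp.2.2.2, hp'.2.2.2])
    have e1 := congrArg (fun q : ℝ × ℝ => Int.fract q.1) heq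
    have e2 := congrArg (fun q : ℝ × ℝ => Int.fract q.2) heq
    simp only [Prod.fst_add, Prod.snd_add, Int.fract_add_intCast] at e1 e2
    rw [Int.fract_eq_self.2 hp.1, Int.fract_eq_self.2 hp'.1] at e1
    rw [Int.fract_eq_self.2 hp.2.1, Int.fract_eq_self.2 hp'.2.1] at e2
    exact Prod.ext e1 e2
  · intro q hq
    rcases hnear J J' hJ hJ' q hq.2.2.2 with ⟨n, hn⟩ | ⟨p, hne, hp0, hd⟩
    · exact absurd (hdiag _ _ n hn (crossingMap_eq_zero.1 hq.2.2.2))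
        (circleNe_of_ne hq.1 hq.2.1 hq.2.2.1 n)
    · have hp := fract_mem_crossings hs hs hne hp0
      refine ⟨_, hp, ?_⟩
      -- The integer shift taking `p` into `[0, 1)²` takes `q` into the ball of a listed crossing,
      -- where injectivity identifies it with the chosen zero.
      have hq' : crossingMap J J' (q + (((-⌊p.1⌋ : ℤ) : ℝ), ((-⌊p.2⌋ : ℤ) : ℝ))) = 0 := by
        rw [hJ.loop.crossingMap_add_int hJ'.loop, hq.2.2.2]
      have hmem : q + (((-⌊p.1⌋ : ℤ) : ℝ), ((-⌊p.2⌋ : ℤ) : ℝ)) ∈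
          Metric.closedBall (Int.fract p.1, Int.fract p.2) ρ := by
        have e : (Int.fract p.1, Int.fract p.2) = p + (((-⌊p.1⌋ : ℤ) : ℝ), ((-⌊p.2⌋ : ℤ) : ℝ)) :=
          Prod.ext (by simp [Int.fract, sub_eq_add_neg]) (by simp [Int.fract, sub_eq_add_neg])
        rw [e, Metric.mem_closedBall, dist_add_right]
        exact hd.le
      have heq := (hcross _ hp J J' hJ hJ').2 (hdouble _ (hc _ hp)) (hdouble _ hmem)
        ((hc0 _ hp).trans hq'.symm)
      simp only [heq, Prod.fst_add, Prod.snd_add, Int.fract_add_intCast]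
      exact Prod.ext (Int.fract_eq_self.2 hq.1) (Int.fract_eq_self.2 hq.2.1)
  · intro p hp
    obtain ⟨h1, h2, h3⟩ := hsign p hp J J' hJ hJ' _ (hc p hp)
    simp only [hJ.loop.deriv_fract, hJ'.loop.deriv_fract, hJ.loop.apply_fract,
      hJ'.loop.apply_fract, crossingSign_fract hJ.loop hJ'.loop]
    exact ⟨h1, h2, h3.symm⟩

end Bijection

/-! ### The factor two between ordered crossings and the writhe. -/

section Writhe

/-- Each crossing occurs in both orders with equal signs; this doubling cancels the one half in
`lk`. -/
lemma IsKnotDiagram.finsum_crossings {K : ℝ → E3} (hK : IsKnotDiagram K) :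
    ∑ᶠ p ∈ crossings K K, crossingSign K K p.1 p.2 = 2 * writhe K := by
  have hsub : selfCrossings K ⊆ crossings K K := fun p hp =>
    ⟨⟨hp.1, hp.2.1.trans hp.2.2.1⟩, ⟨hp.1.trans hp.2.1.le, hp.2.2.1⟩, hp.2.1.ne,
      crossingMap_eq_zero.2 hp.2.2.2⟩
  have hfin : (selfCrossings K).Finite := hK.finite_crossings.subset hsub
  have hunion : crossings K K = selfCrossings K ∪ Prod.swap '' selfCrossings K := by
    refine Subset.antisymm (fun p hp => ?_) (union_subset hsub ?_)
    · have h0 := crossingMap_eq_zero.1 hp.2.2.2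
      rcases lt_or_gt_of_ne hp.2.2.1 with h | h
      · exact Or.inl ⟨hp.1.1, h, hp.2.1.2, h0⟩
      · exact Or.inr ⟨p.swap, ⟨hp.2.1.1, h, hp.1.2, h0.symm⟩, p.swap_swap⟩
    · rintro _ ⟨p, hp, rfl⟩
      have := hsub hp
      exact ⟨this.2.1, this.1, this.2.2.1.symm,
        crossingMap_eq_zero.2 (crossingMap_eq_zero.1 this.2.2.2).symm⟩
  have hdisj : Disjoint (selfCrossings K) (Prod.swap '' selfCrossings K) := by
    rw [Set.disjoint_left]
    rintro _ hp ⟨q, hq, rfl⟩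
    exact lt_asymm hp.2.1 hq.2.1
  rw [hunion, finsum_mem_union hdisj hfin (hfin.image _),
    finsum_mem_image Prod.swap_injective.injOn, two_mul, writhe]
  congr 1
  exact finsum_mem_congr rfl fun p hp => (crossingSign_comm (hK.height_ne (hsub hp))).symm

end Writhe

/-! ### Assembly of the link diagram and its linking number. -/

/-- A knot and a small push-off along a blackboard framing form a link diagram whose linking
number is the writhe of the knot. -/
lemma IsKnotDiagram.exists_isLinkDiagram {K V : ℝ → E3} (hK : IsKnotDiagram K)
    (hV : IsBlackboardFraming K V) :
    ∃ δ > 0, ∀ J, IsPushOff K V δ J → IsLinkDiagram ![K, J] ∧ lk K J = writhe K := by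
  have hs := hK.isSmoothLoop
  have him : ∀ t, proj (deriv K t) ≠ 0 := hK.immersed ()
  obtain ⟨η₁, hη₁, himm⟩ := exists_planeInner_deriv_pos hs him
  obtain ⟨η, hη, hdiag⟩ := exists_eq_of_proj_eq hs him hV
  obtain ⟨δ, ⟨⟨⟨hδ, hδ₁⟩, hδη⟩, hbij⟩, htriple⟩ := ((((eventually_mem_nhdsWithin.and
    (Ioo_mem_nhdsGT hη₁)).and (Ioo_mem_nhdsGT hη)).and
    (hK.eventually_exists_bijOn hη)).and (hK.eventually_no_triple_points hη)).exists
  refine ⟨δ, hδ, fun J hJ => ?_⟩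
  have hJη : IsPushOff K V η J :=
    ⟨hJ.loop, hJ.shift, fun t => (hJ.close t).trans hδη.2,
      fun t => (hJ.close_deriv t).trans hδη.2⟩
  replace hdiag := hdiag J hJη
  have hnear : ∀ i, IsNear K δ ((![K, J] : Fin 2 → ℝ → E3) i) := by
    intro i; fin_cases i; exacts [hs.isNear_self hδ, hJ.isNear]
  have hlk : lk K J = writhe K := by
    obtain ⟨g, hg, hsign⟩ := hbij K J (hnear 0) (hnear 1)
      fun s t n hn heq => (hdiag 0 1 s t n hn heq).2
    -- Only `crossings` demands distinct parameters, but `K t` and `J t` never have the same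
    -- projection.
    have hmixed : mixedCrossings K J = crossings K J := by
      refine Subset.antisymm (fun q hq => ⟨hq.1, hq.2.1, fun h => ?_,
        crossingMap_eq_zero.2 hq.2.2⟩) fun q hq => ⟨hq.1, hq.2.1, crossingMap_eq_zero.1 hq.2.2.2⟩
      exact hJ.proj_ne hV q.1 (by rw [hq.2.2, h])
    rw [lk, hmixed, ← finsum_mem_eq_of_bijOn (f := fun p => crossingSign K K p.1 p.2) g hg
      fun p hp => (hsign p hp).2.2, hK.finsum_crossings]
    push_cast
    ring
  refine ⟨?_, hlk⟩
  -- From here only nearness to `K` and the absence of near-diagonal crossings matter, so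
  -- self-crossings and mixed crossings are treated alike.
  generalize (![K, J] : Fin 2 → ℝ → E3) = L at hdiag hnear ⊢
  have hloop : ∀ i, IsSmoothLoop (L i) := fun i => (hnear i).loop
  have hmem : ∀ c ∈ doublePoints L, (c.1.2, c.2.2) ∈ crossings (L c.1.1) (L c.2.1) := by
    intro c hc
    refine ⟨hc.1, hc.2.1, fun h => hc.2.2.1 (Prod.ext ?_ h), crossingMap_eq_zero.2 hc.2.2.2⟩
    simp only at h
    exact (hdiag _ _ c.1.2 c.2.2 0 (by simpa [h] using hη) hc.2.2.2).1
  have hcross : ∀ i j, ∃ g : ℝ × ℝ → ℝ × ℝ, BijOn g (crossings K K) (crossings (L i) (L j)) ∧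
      ∀ p ∈ crossings K K, planeDet (deriv (L i) (g p).1) (deriv (L j) (g p).2) ≠ 0 ∧
        L i (g p).1 2 ≠ L j (g p).2 2 := by
    intro i j
    obtain ⟨g, hg, h⟩ := hbij (L i) (L j) (hnear i) (hnear j)
      fun s t n hn heq => (hdiag i j s t n hn heq).2
    exact ⟨g, hg, fun p hp => ⟨(h p hp).1, (h p hp).2.1⟩⟩
  have hgen : ∀ i j, ∀ q ∈ crossings (L i) (L j),
      planeDet (deriv (L i) q.1) (deriv (L j) q.2) ≠ 0 ∧ L i q.1 2 ≠ L j q.2 2 := by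
    intro i j q hq
    obtain ⟨g, hg, h⟩ := hcross i j
    obtain ⟨p, hp, rfl⟩ := hg.surjOn hq
    exact h p hp
  have hfar : ∀ c ∈ doublePoints L, ¬∃ n : ℤ, |c.1.2 - c.2.2 - n| < η := by
    rintro c hc ⟨n, hn⟩
    exact circleNe_of_ne hc.1 hc.2.1 (hmem c hc).2.2.1 n (hdiag _ _ _ _ n hn hc.2.2.2).2
  have himL : ∀ i t, proj (deriv (L i) t) ≠ 0 := fun i t =>
    proj_ne_zero_of_planeInner_pos
      (himm _ ((hnear i).mono hδ₁.2.le) t t (by simpa using hη₁))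
  refine ⟨⟨fun i => ⟨hloop i, fun t h0 => himL i t (proj_eq_zero_iff.2 (by simp [h0])), ?_⟩, ?_⟩,
    himL, ?_, fun c hc => (hgen _ _ _ (hmem c hc)).1, ?_⟩
  · intro s hs t ht hst
    by_contra hne
    exact (hgen i i (s, t) ⟨hs, ht, hne, crossingMap_eq_zero.2 (congrArg proj hst)⟩).2
      (congrArg (fun v : E3 => v 2) hst)
  · intro i j hij
    rw [Set.disjoint_left]
    rintro _ ⟨s, rfl⟩ ⟨t, ht⟩
    rw [← (hloop i).apply_fract s, ← (hloop j).apply_fract t] at ht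
    have hc : ((i, Int.fract s), (j, Int.fract t)) ∈ doublePoints L :=
      ⟨fract_mem_Ico _, fract_mem_Ico _, fun h => hij (Prod.ext_iff.1 h).1,
        congrArg proj ht.symm⟩
    exact (hgen _ _ _ (hmem _ hc)).2 (congrArg (fun v : E3 => v 2) ht.symm)
  · refine (finite_iUnion fun i => finite_iUnion fun j => Set.Finite.image
      (fun q : ℝ × ℝ => ((i, q.1), (j, q.2))) (?_ : (crossings (L i) (L j)).Finite)).subset
      fun c hc => mem_iUnion.2 ⟨c.1.1, mem_iUnion.2 ⟨c.2.1, _, hmem c hc, rfl⟩⟩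
    obtain ⟨g, hg, -⟩ := hcross i j
    exact hg.image_eq ▸ hK.finite_crossings.image g
  -- A triple point gives three double points, none near the diagonal by `hfar`, whereas `htriple`
  -- puts one of them there.
  · intro x y z hxy hxz
    by_contra hyz
    have hc : (y, z) ∈ doublePoints L :=
      ⟨hxy.2.1, hxz.2.1, hyz, hxy.2.2.2.symm.trans hxz.2.2.2⟩
    rcases htriple _ _ _ (hnear x.1) (hnear y.1) (hnear z.1) x.2 y.2 z.2 hxy.2.2.2 hxz.2.2.2
      with h | h | h
    exacts [hfar _ hxy h, hfar _ hxz h, hfar _ hc h]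

end BlackboardFraming

theorem mainTheorem4 (K V : ℝ → BlackboardFraming.E3)
    (hK : BlackboardFraming.IsKnotDiagram K)
    (hV : BlackboardFraming.IsBlackboardFraming K V) :
    BlackboardFraming.HasSelfLinkingNumber K V (BlackboardFraming.writhe K : ℚ) :=
  ⟨fun _ hδ => BlackboardFraming.exists_isPushOff hK.isSmoothLoop (hK.immersed ()) hV hδ,
    hK.exists_isLinkDiagram hV⟩
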